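/- Let $X$ be a (real or complex) Banach space; subspaces are linear. A sequence indexed by an infinite set $A\subseteq\mathbb N$ is written $(M_n)_{A}$, and limits and upper limits "along $A$" are taken as $n\to\infty$, $n\in A$. **Definitions.** Let $(M_n)_A$, $(P_n)_A$ be sequences of closed subspaces of $X$. * For $\lambda\ge 0$, $(M_n)_A$ is *lower uniformly $\lambda$-adjusted* with $(P_n)_A$ if for every $\eta>0$, every infinite $B\subseteq A$ and every choice of unit vectors $x_n\in M_n$ $(n\in B)$ there are an infinite $C\subseteq B$, vectors $y_n\in P_n$ $(n\in C)$ and $z\in X$ with $\varlimsup_{n\in C}\|x_n-y_n-z\|\le\lambda+\eta$. Let $\lambda_A[M_n,P_n]$ be the infimum of all such $\lambda\ge0$. * $\mathcal{SS}\lambda_A[M_n,P_n]$ is the infimum of all $\lambda\ge 0$ such that for every infinite $B\subseteq A$ and all closed infinite-dimensional subspaces $K_n\subseteq M_n$ $(n\in B)$ there are an infinite $C\subseteq B$ and closed infinite-dimensional subspaces $L_n\subseteq K_n$ $(n\in C)$ with $\lambda_C[L_n,P_n]\le\lambda$. * $\mathcal{FSS}\lambda_A[M_n,P_n]$ is the infimum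 of all $\lambda\ge 0$ such that for every infinite $B\subseteq A$ and all finite-dimensional subspaces $K_n\subseteq M_n$ $(n\in B)$ with $\lim_{n\in B}\dim K_n=\infty$ there are an infinite $C\subseteq B$ and subspaces $L_n\subseteq K_n$ $(n\in C)$ with $\lim_{n\in C}\dim L_n=\infty$ and $\lambda_C[L_n,P_n]\le\lambda$. * A single subspace $P$ in place of $(P_n)_A$ denotes the constant sequence. * A pair $(M,N)$ of closed subspaces is *lower semi-Fredholm* if $M+N$ is closed and $\alpha(M,N):=\dim(M\cap N)<\infty$. * For a lower semi-Fredholm pair $(M,N)$ and a closed subspace $S$ with $M+N=(M\cap N)\oplus S$, let $\varphi_S(M,N)=\|\Phi^{-1}\|$, where $\Phi:(M\cap S)\times(M\cap N)\times(N\cap S)\to M+N$, $\Phi(u,t,v)=u+t+v$, is the resulting linear isomorphism, the product being normed by $\max\{\|u\|,\|t\|,\|v\|\}$. Let $\varphi(M,N)$ be the infimum of $\varphi_S(M,N)$ over all such $S$. **Theorem (Lower semi-Fredholm pairs are stable under singular adjustment).** Let $(M,N)$ be a lower semi-Fredholm pair of closed subspaces of $X$, let $A\subseteq\mathbb N$ be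 infinite, and let $(M_n)_A$, $(N_n)_A$ be sequences of closed subspaces of $X$. For $a,b\ge0$ put $\omega(a,b)=2\bigl(\min(a,b)+\varphi(M,N)(a+b)\bigr)$. 1. If $\omega\bigl(\mathcal{FSS}\lambda_A[M_n,M],\,\mathcal{FSS}\lambda_A[N_n,N]\bigr)<\tfrac12$, then for all large enough $n\in A$ the pairs $(M_n,N_n)$ are lower semi-Fredholm, and $\varlimsup_{n\in A}\alpha(M_n,N_n)<\infty$. 2. If $\omega\bigl(\mathcal{SS}\lambda_A[M_n,M],\,\mathcal{SS}\lambda_A[N_n,N]\bigr)<\tfrac12$, then for all large enough $n\in A$ the pairs $(M_n,N_n)$ are lower semi-Fredholm. -/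

import Mathlib

open Filter

noncomputable section

namespace SingularAdjustment

variable {𝕜 : Type*} [RCLike 𝕜] {X : Type*} [NormedAddCommGroup X] [NormedSpace 𝕜 X]

/-- The filter "`n → ∞` with `n ∈ A`" for a set `A` of natural numbers. A sequence indexed by an
infinite set `A` of natural numbers is a function on `ℕ` whose values outside of `A` are ignored;
its subsequences are given by the infinite subsets of `A`. -/
def along (A : Set ℕ) : Filter ℕ := atTop ⊓ 𝓟 A

/-- `(M n)`, `n ∈ A`, is lower uniformly `lam`-adjusted with `(P n)`, `n ∈ A`: for every `η > 0` and
every unit subsequence `x n ∈ M n`, `n ∈ B ⊆ A`, there are a further subsequence `y n ∈ P n`,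
`n ∈ C ⊆ B`, and a vector `z` with `limsup ‖x n - y n - z‖ ≤ lam + η` along `C`. (The upper limit is
taken in `[0, ∞]`.) -/
def IsLowerAdjusted (A : Set ℕ) (M P : ℕ → Submodule 𝕜 X) (lam : ℝ) : Prop :=
  ∀ η : ℝ, 0 < η → ∀ B : Set ℕ, B ⊆ A → B.Infinite →
    ∀ x : ℕ → X, (∀ n ∈ B, x n ∈ M n ∧ ‖x n‖ = 1) →
      ∃ C : Set ℕ, C ⊆ B ∧ C.Infinite ∧
        ∃ y : ℕ → X, (∀ n ∈ C, y n ∈ P n) ∧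
          ∃ z : X, limsup (fun n => ‖x n - y n - z‖ₑ) (along C) ≤ ENNReal.ofReal (lam + η)

/-- The uniform adjustment `λ_A[M n, P n]`. -/
def adj (A : Set ℕ) (M P : ℕ → Submodule 𝕜 X) : ℝ :=
  sInf {lam : ℝ | 0 ≤ lam ∧ IsLowerAdjusted A M P lam}

/-- `(M n)`, `n ∈ A`, is lower strictly singular uniformly `lam`-adjusted with `(P n)`, `n ∈ A`. -/
def IsLowerSSAdjusted (A : Set ℕ) (M P : ℕ → Submodule 𝕜 X) (lam : ℝ) : Prop :=
  ∀ B : Set ℕ, B ⊆ A → B.Infinite → ∀ K : ℕ → Submodule 𝕜 X,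
    (∀ n ∈ B, K n ≤ M n ∧ IsClosed (K n : Set X) ∧ ¬ FiniteDimensional 𝕜 (K n)) →
      ∃ C : Set ℕ, C ⊆ B ∧ C.Infinite ∧ ∃ L : ℕ → Submodule 𝕜 X,
        (∀ n ∈ C, L n ≤ K n ∧ IsClosed (L n : Set X) ∧ ¬ FiniteDimensional 𝕜 (L n)) ∧
          adj C L P ≤ lam

/-- The strictly singular uniform adjustment `SSλ_A[M n, P n]`. -/
def ssAdj (A : Set ℕ) (M P : ℕ → Submodule 𝕜 X) : ℝ :=
  sInf {lam : ℝ | 0 ≤ lam ∧ IsLowerSSAdjusted A M P lam}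

/-- `(M n)`, `n ∈ A`, is lower finitely strictly singular uniformly `lam`-adjusted with `(P n)`,
`n ∈ A`. (The subspaces `L n` are finite-dimensional, being contained in `K n`.) -/
def IsLowerFSSAdjusted (A : Set ℕ) (M P : ℕ → Submodule 𝕜 X) (lam : ℝ) : Prop :=
  ∀ B : Set ℕ, B ⊆ A → B.Infinite → ∀ K : ℕ → Submodule 𝕜 X,
    (∀ n ∈ B, K n ≤ M n ∧ FiniteDimensional 𝕜 (K n)) →
    Tendsto (fun n => Module.finrank 𝕜 (K n)) (along B) atTop →
      ∃ C : Set ℕ, C ⊆ B ∧ C.Infinite ∧ ∃ L : ℕ → Submodule 𝕜 X,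
        (∀ n ∈ C, L n ≤ K n) ∧
        Tendsto (fun n => Module.finrank 𝕜 (L n)) (along C) atTop ∧
          adj C L P ≤ lam

/-- The finitely strictly singular uniform adjustment `FSSλ_A[M n, P n]`. -/
def fssAdj (A : Set ℕ) (M P : ℕ → Submodule 𝕜 X) : ℝ :=
  sInf {lam : ℝ | 0 ≤ lam ∧ IsLowerFSSAdjusted A M P lam}

/-- The lower defect number `α(M, N) = dim (M ∩ N)`, a natural number or `∞`. -/
def lowerDefect (M N : Submodule 𝕜 X) : ℕ∞ :=
  Cardinal.toENat (Module.rank 𝕜 (M ⊓ N : Submodule 𝕜 X))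

/-- A lower semi-Fredholm pair of closed subspaces: `M + N` is closed and `α(M, N) < ∞`. -/
structure IsLowerSemiFredholm (M N : Submodule 𝕜 X) : Prop where
  closed_left : IsClosed (M : Set X)
  closed_right : IsClosed (N : Set X)
  closed_sum : IsClosed ((M ⊔ N : Submodule 𝕜 X) : Set X)
  defect_lt_top : lowerDefect M N < ⊤

/-- The closed subspace `S` satisfies `M + N = (M ∩ N) ⊕ S`. -/
structure IsComplementOfInf (M N S : Submodule 𝕜 X) : Prop where
  closed : IsClosed (S : Set X)
  disjoint : Disjoint (M ⊓ N) S
  sup_eq : (M ⊓ N) ⊔ S = M ⊔ N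

/-- The map `Φ : (M ∩ S) × (M ∩ N) × (N ∩ S) → M + N`, `(u, t, v) ↦ u + t + v`, where the product
carries the maximum norm. -/
def sumMap (M N S : Submodule 𝕜 X) :
    ((M ⊓ S : Submodule 𝕜 X) × (M ⊓ N : Submodule 𝕜 X) × (N ⊓ S : Submodule 𝕜 X)) →L[𝕜]
      (M ⊔ N : Submodule 𝕜 X) :=
  ((M ⊓ S).subtypeL.coprod ((M ⊓ N).subtypeL.coprod (N ⊓ S).subtypeL)).codRestrict (M ⊔ N)
    (fun p => add_mem (Submodule.mem_sup_left p.1.2.1)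
      (add_mem (Submodule.mem_sup_left p.2.1.2.1) (Submodule.mem_sup_right p.2.2.2.1)))

/-- `φ_S(M, N) = ‖Φ⁻¹‖`. -/
def phiOf (M N S : Submodule 𝕜 X) : ℝ := ‖(sumMap M N S).inverse‖

/-- `φ(M, N)`, the infimum of `φ_S(M, N)` over the closed subspaces `S` with
`M + N = (M ∩ N) ⊕ S`. -/
def phi (M N : Submodule 𝕜 X) : ℝ :=
  sInf {r : ℝ | ∃ S : Submodule 𝕜 X, IsComplementOfInf M N S ∧ r = phiOf M N S}

/-- The number `2 (min(a, b) + φ(M, N) (a + b))`. -/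
def omega (M N : Submodule 𝕜 X) (a b : ℝ) : ℝ := 2 * (min a b + phi M N * (a + b))

end SingularAdjustment

end

namespace SingularAdjustment

variable {𝕜 : Type*} [RCLike 𝕜] {X : Type*} [NormedAddCommGroup X] [NormedSpace 𝕜 X]

/-! If the conclusion fails along infinitely many `n`, there are subspaces `K n ≤ Mn n`,
infinite-dimensional or of dimension tending to infinity, and operators `T n` tending to the
identity in norm with `T n (K n) ≤ Nn n` (`exists_perturbation_of_not_isLowerSemiFredholm`).
Adjusting subspaces of `K n` to `M`, and then subspaces of their images to `N`, leaves spaces `H n`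
of growing or infinite dimension whose unit vectors lie, along subsequences, within about `a` of a
translate of `M` and within about `b` of a translate of `N`, the translates being independent of
`n`.

Two facts then collide. By Riesz's lemma and the pigeonhole principle, unit vectors `x n ∈ H n` can
be chosen with mutual distances at least `r`, for any `r < 1/2` (`exists_separated_subsequence`). On
the other hand, split the approximants along `(M ∩ S) ⊕ (M ∩ N) ⊕ (N ∩ S)`. The `M ∩ N` components
of the approximants in `M` are bounded in a finite-dimensional space, so two of them nearly agree;
the translations cancel in differences, so the difference of the `M ∩ S` components is at most about
`2 φ (a + b)`. Hence two of the `x n` are within about `2 (a + φ (a + b))`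
(`exists_ne_norm_sub_lt_of_decomposition`). Exchanging `M` and `N` replaces the first `a` by `b`,
whence the minimum in `omega`. -/

theorem frequently_along {A : Set ℕ} {p : ℕ → Prop} :
    (∃ᶠ n in along A, p n) ↔ {n | n ∈ A ∧ p n}.Infinite := by
  rw [along, frequently_inf_principal, Nat.frequently_atTop_iff_infinite]

theorem eventually_along_mem (A : Set ℕ) : ∀ᶠ n in along A, n ∈ A :=
  eventually_inf_principal.2 (Eventually.of_forall fun _ h => h)

theorem infinite_of_eventually_along {C : Set ℕ} (hC : C.Infinite) {p : ℕ → Prop}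
    (h : ∀ᶠ n in along C, p n) : {n | n ∈ C ∧ p n}.Infinite := by
  rw [← frequently_along]
  have : ∃ᶠ n in along C, n ∈ C := by
    rw [frequently_along]; simpa using hC
  exact (this.and_eventually h).mono fun n hn => hn.2

/-! ### Separated unit vectors and compactness -/

/-- A space of dimension at least `k` contains `k` unit vectors with mutual distances at
least `r`, for any given `r < 1`. -/
theorem exists_separated_unit_vectors {r : ℝ} (hr0 : 0 < r) (hr : r < 1) (L : Submodule 𝕜 X)
    (k : ℕ) (hk : (k : Cardinal) ≤ Module.rank 𝕜 L) :
    ∃ s : Finset X, s.card = k ∧ (∀ x ∈ s, x ∈ L ∧ ‖x‖ = 1) ∧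
      ∀ x ∈ s, ∀ y ∈ s, x ≠ y → r ≤ ‖x - y‖ := by
  classical
  induction k with
  | zero => exact ⟨∅, by simp⟩
  | succ k ih =>
    obtain ⟨s, hs, hL, hsep⟩ := ih (le_trans (by exact_mod_cast Nat.le_succ k) hk)
    set F : Submodule 𝕜 X := Submodule.span 𝕜 (s : Set X) with hF
    have hnot : ¬ L ≤ F := by
      intro h
      have h1 := (hk.trans (Submodule.rank_mono h)).trans (rank_span_finset_le s)
      rw [hs] at h1
      exact absurd (Nat.cast_le.1 h1) (by omega)
    obtain ⟨w, hwL, hwF⟩ := SetLike.not_le_iff_exists.1 hnot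
    have : FiniteDimensional 𝕜 F := FiniteDimensional.span_finset 𝕜 s
    -- Riesz's lemma is applied inside `L`, to the trace of `F`, so that the new vector stays in
    -- `L`.
    have : FiniteDimensional 𝕜 (F.comap L.subtype) :=
      Module.Finite.of_injective (L.subtype.restrict (p := F.comap L.subtype) (q := F)
        fun x hx => hx) (by
          intro a b hab
          exact Subtype.ext (Subtype.ext (congrArg (fun z : F => (z : X)) hab)))
    obtain ⟨v, hvF, hv⟩ := riesz_lemma (F := F.comap L.subtype)
      (Submodule.closed_of_finiteDimensional _) ⟨⟨w, hwL⟩, hwF⟩ hr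
    have hv0 : (v : X) ≠ 0 := fun h => hvF (by
      change (v : X) ∈ F; rw [h]; exact F.zero_mem)
    have hn : 0 < ‖(v : X)‖ := norm_pos_iff.2 hv0
    set u : X := ((‖(v : X)‖ : 𝕜))⁻¹ • (v : X) with hu
    have hdist : ∀ y ∈ s, r ≤ ‖u - y‖ := by
      intro y hy
      have hyF : ((‖(v : X)‖ : 𝕜)) • y ∈ F :=
        F.smul_mem _ (Submodule.subset_span hy)
      have h1 := hv ⟨((‖(v : X)‖ : 𝕜)) • y, L.smul_mem _ (hL y hy).1⟩ hyF
      have h2 : (v : X) - ((‖(v : X)‖ : 𝕜)) • y = ((‖(v : X)‖ : 𝕜)) • (u - y) := by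
        rw [smul_sub, hu, smul_inv_smul₀ (by exact_mod_cast hn.ne')]
      have h3 : r * ‖(v : X)‖ ≤ ‖(v : X) - ((‖(v : X)‖ : 𝕜)) • y‖ := h1
      rw [h2, norm_smul, RCLike.norm_ofReal, abs_of_pos hn, mul_comm r] at h3
      exact le_of_mul_le_mul_left h3 hn
    have hus : u ∉ s := fun h => by
      have := hdist u h
      simp at this; linarith
    refine ⟨insert u s, by rw [Finset.card_insert_of_notMem hus, hs], ?_, ?_⟩
    · intro x hx
      rcases Finset.mem_insert.1 hx with rfl | hx
      · exact ⟨L.smul_mem _ v.2, norm_smul_inv_norm hv0⟩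
      · exact hL x hx
    · intro x hx y hy hxy
      rcases Finset.mem_insert.1 hx with rfl | hx <;> rcases Finset.mem_insert.1 hy with h | hy
      · exact absurd h.symm hxy
      · exact hdist y hy
      · rw [h, norm_sub_rev]; exact hdist x hx
      · exact hsep x hx y hy hxy

/-- If `dim L n → ∞`, then there is a subsequence of unit vectors `x n ∈ L n` with mutual distances
at least `r`, for any given `r < 1 / 2`. -/
theorem exists_separated_subsequence {r : ℝ} (hr0 : 0 < r) (hr : r < 1 / 2) {C : Set ℕ}
    (hC : C.Infinite) (L : ℕ → Submodule 𝕜 X)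
    (hL : ∀ k : ℕ, ∀ᶠ n in along C, (k : Cardinal) ≤ Module.rank 𝕜 (L n)) :
    ∃ D : Set ℕ, D ⊆ C ∧ D.Infinite ∧ ∃ x : ℕ → X, (∀ n ∈ D, x n ∈ L n ∧ ‖x n‖ = 1) ∧
      ∀ n ∈ D, ∀ m ∈ D, n ≠ m → r ≤ ‖x n - x m‖ := by
  classical
  obtain ⟨f, hf, hfr⟩ := exists_seq_of_forall_finset_exists
    (fun p : ℕ × X => p.1 ∈ C ∧ p.2 ∈ L p.1 ∧ ‖p.2‖ = 1)
    (fun p q => p.1 < q.1 ∧ r ≤ ‖q.2 - p.2‖) (by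
      intro s _
      obtain ⟨n, ⟨hnC, hn⟩, hns⟩ := (infinite_of_eventually_along hC (hL (s.card + 1))).exists_gt
        (s.sup Prod.fst)
      -- There is one more candidate than there are earlier vectors. The candidates are `2 *
      -- r`-separated, so no earlier vector is within `r` of two of them, and one candidate
      -- survives. Riesz's lemma needs `2 * r < 1`.
      obtain ⟨w, hw, hwL, hsep⟩ := exists_separated_unit_vectors (r := 2 * r) (by linarith)
        (by linarith) (L n) _ hn
      by_cases h : ∃ u ∈ w, ∀ p ∈ s, r ≤ ‖u - p.2‖
      · obtain ⟨u, hu, hup⟩ := h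
        exact ⟨(n, u), ⟨hnC, hwL u hu⟩, fun p hp =>
          ⟨lt_of_le_of_lt (Finset.le_sup (f := Prod.fst) hp) hns, hup p hp⟩⟩
      · push Not at h
        choose! g hg using h
        obtain ⟨u, hu, v, hv, huv, he⟩ := Finset.exists_ne_map_eq_of_card_lt_of_maps_to
          (s := w) (t := s) (by omega) (f := g) (fun u hu => (hg u hu).1)
        have h1 := hsep u hu v hv huv
        have h2 := (hg u hu).2
        have h3 := (hg v hv).2
        rw [he] at h2
        rw [norm_sub_rev] at h3
        have h4 : ‖u - v‖ ≤ ‖u - (g v).2‖ + ‖(g v).2 - v‖ := norm_sub_le_norm_sub_add_norm_sub _ _ _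
        linarith)
  have hmono : StrictMono (fun k => (f k).1) := fun a b hab => (hfr a b hab).1
  have hx : ∀ k, Function.extend (fun k => (f k).1) (fun k => (f k).2) 0 (f k).1 = (f k).2 :=
    fun k => hmono.injective.extend_apply _ _ k
  refine ⟨Set.range fun k => (f k).1, ?_, Set.infinite_range_of_injective hmono.injective,
    Function.extend (fun k => (f k).1) (fun k => (f k).2) 0, ?_, ?_⟩
  · rintro _ ⟨k, rfl⟩
    exact (hf k).1
  · rintro _ ⟨k, rfl⟩
    simp only [hx]
    exact (hf k).2
  · rintro _ ⟨k, rfl⟩ _ ⟨l, rfl⟩ hkl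
    simp only [hx]
    rcases lt_trichotomy k l with h | h | h
    · rw [norm_sub_rev]; exact (hfr k l h).2
    · exact absurd (by rw [h]) hkl
    · exact (hfr l k h).2

theorem exists_ne_norm_sub_lt {F : Type*} [NormedAddCommGroup F] [NormedSpace 𝕜 F]
    [FiniteDimensional 𝕜 F] {D : Set ℕ} (hD : D.Infinite) (t : ℕ → F) {R : ℝ}
    (ht : ∀ n ∈ D, ‖t n‖ ≤ R) {ε : ℝ} (hε : 0 < ε) :
    ∃ n ∈ D, ∃ m ∈ D, n ≠ m ∧ ‖t n - t m‖ < ε := by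
  classical
  have : ProperSpace F := FiniteDimensional.proper 𝕜 F
  have : Infinite D := hD.to_subtype
  set e := Nat.orderEmbeddingOfSet D
  have he : ∀ n, e n ∈ D := fun n => Nat.orderEmbeddingOfSet_range D ▸ Set.mem_range_self n
  obtain ⟨a, _, φ, hφ, hlim⟩ := tendsto_subseq_of_bounded
    (Metric.isBounded_closedBall (x := (0 : F)) (r := R)) (x := fun n => t (e n))
    (fun n => by simpa using ht _ (he n))
  obtain ⟨K, hK⟩ := Metric.cauchySeq_iff.1 hlim.cauchySeq ε hε
  refine ⟨e (φ K), he _, e (φ (K + 1)), he _, ?_, ?_⟩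
  · intro h
    have := hφ.injective (e.injective h)
    omega
  · rw [← dist_eq_norm]
    exact hK K le_rfl (K + 1) (Nat.le_succ K)

/-! ### Complements of the intersection and the constant `phi` -/

/-- The finite-dimensional `M ⊓ N` has a closed complement in `X`, and the modular law cuts it down
to `M ⊔ N`. Thus `phi` is not the default value of an infimum over the empty set. -/
theorem exists_isComplementOfInf {M N : Submodule 𝕜 X} (h : IsLowerSemiFredholm M N) :
    ∃ S, IsComplementOfInf M N S := by
  have : FiniteDimensional 𝕜 (M ⊓ N : Submodule 𝕜 X) := by
    have := h.defect_lt_top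
    rw [lowerDefect, Cardinal.toENat_lt_top] at this
    exact Module.rank_lt_aleph0_iff.1 this
  obtain ⟨Q, hQ, hc⟩ := (Submodule.ClosedComplemented.of_finiteDimensional
    (M ⊓ N : Submodule 𝕜 X)).exists_isClosed_isCompl
  refine ⟨Q ⊓ (M ⊔ N), hQ.inter h.closed_sum, hc.disjoint.mono_right inf_le_left, ?_⟩
  rw [← sup_inf_assoc_of_le _ (inf_le_left.trans le_sup_left), hc.sup_eq_top, top_inf_eq]

theorem phiOf_nonneg (M N S : Submodule 𝕜 X) : 0 ≤ phiOf M N S := norm_nonneg _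

theorem phi_nonneg (M N : Submodule 𝕜 X) : 0 ≤ phi M N :=
  Real.sInf_nonneg (by rintro _ ⟨S, _, rfl⟩; exact phiOf_nonneg M N S)

theorem exists_phiOf_lt {M N : Submodule 𝕜 X} (h : IsLowerSemiFredholm M N) {p : ℝ}
    (hp : phi M N < p) : ∃ S, IsComplementOfInf M N S ∧ phiOf M N S < p := by
  obtain ⟨S, hS⟩ := exists_isComplementOfInf h
  obtain ⟨_, ⟨S', hS', rfl⟩, hlt⟩ := exists_lt_of_csInf_lt (by exact ⟨_, S, hS, rfl⟩) hp
  exact ⟨S', hS', hlt⟩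

theorem IsComplementOfInf.exists_add_left {M N S : Submodule 𝕜 X} (h : IsComplementOfInf M N S)
    {x : X} (hx : x ∈ M) : ∃ u ∈ M ⊓ S, ∃ t ∈ M ⊓ N, x = u + t := by
  have hx' : x ∈ (M ⊓ N) ⊔ S := h.sup_eq ▸ Submodule.mem_sup_left hx
  obtain ⟨t, ht, u, hu, rfl⟩ := Submodule.mem_sup.1 hx'
  exact ⟨u, ⟨(M.add_mem_iff_right ht.1).1 hx, hu⟩, t, ht, add_comm _ _⟩

theorem IsComplementOfInf.exists_add_right {M N S : Submodule 𝕜 X} (h : IsComplementOfInf M N S)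
    {x : X} (hx : x ∈ N) : ∃ v ∈ N ⊓ S, ∃ t ∈ M ⊓ N, x = v + t := by
  have hx' : x ∈ (M ⊓ N) ⊔ S := h.sup_eq ▸ Submodule.mem_sup_right hx
  obtain ⟨t, ht, u, hu, rfl⟩ := Submodule.mem_sup.1 hx'
  exact ⟨u, ⟨(N.add_mem_iff_right ht.2).1 hx, hu⟩, t, ht, add_comm _ _⟩

theorem sumMap_ker {M N S : Submodule 𝕜 X} (hS : IsComplementOfInf M N S) :
    (sumMap M N S).toLinearMap.ker = ⊥ := by
  rw [LinearMap.ker_eq_bot']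
  rintro ⟨⟨u, hu⟩, ⟨t, ht⟩, ⟨v, hv⟩⟩ h0
  have h0 : u + (t + v) = 0 := congrArg Subtype.val h0
  have ht0 : t = 0 := by
    refine Submodule.disjoint_def.1 hS.disjoint t ht ?_
    have : t = -(u + v) := by rw [eq_neg_iff_add_eq_zero, ← h0]; abel
    rw [this]
    exact S.neg_mem (S.add_mem hu.2 hv.2)
  subst ht0
  have huv : u = -v := by rw [eq_neg_iff_add_eq_zero, ← h0]; abel
  have hu0 : u = 0 :=
    Submodule.disjoint_def.1 hS.disjoint u ⟨hu.1, huv ▸ N.neg_mem hv.1⟩ hu.2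
  subst hu0
  have hv0 : v = 0 := by simpa using huv
  subst hv0
  rfl

theorem sumMap_range {M N S : Submodule 𝕜 X} (hS : IsComplementOfInf M N S) :
    (sumMap M N S).toLinearMap.range = ⊤ := by
  rw [LinearMap.range_eq_top]
  rintro ⟨x, hx⟩
  obtain ⟨y, hy, z, hz, rfl⟩ := Submodule.mem_sup.1 hx
  obtain ⟨u, hu, t, ht, rfl⟩ := hS.exists_add_left hy
  obtain ⟨v, hv, t', ht', rfl⟩ := hS.exists_add_right hz
  refine ⟨(⟨u, hu⟩, ⟨t + t', add_mem ht ht'⟩, ⟨v, hv⟩), Subtype.ext ?_⟩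
  change u + ((t + t') + v) = u + t + (v + t')
  abel

/-- By the open mapping theorem the bijection `sumMap` is a topological isomorphism, so `inverse` is
its true inverse and not the default `0`. -/
theorem norm_le_phiOf [CompleteSpace X] {M N S : Submodule 𝕜 X} (h : IsLowerSemiFredholm M N)
    (hS : IsComplementOfInf M N S) {u t v : X} (hu : u ∈ M ⊓ S) (ht : t ∈ M ⊓ N)
    (hv : v ∈ N ⊓ S) :
    ‖u‖ ≤ phiOf M N S * ‖u + t + v‖ ∧ ‖t‖ ≤ phiOf M N S * ‖u + t + v‖ ∧
      ‖v‖ ≤ phiOf M N S * ‖u + t + v‖ := by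
  have : CompleteSpace (M ⊓ S : Submodule 𝕜 X) :=
    (h.closed_left.inter hS.closed).completeSpace_coe
  have : CompleteSpace (M ⊓ N : Submodule 𝕜 X) :=
    (h.closed_left.inter h.closed_right).completeSpace_coe
  have : CompleteSpace (N ⊓ S : Submodule 𝕜 X) :=
    (h.closed_right.inter hS.closed).completeSpace_coe
  have : CompleteSpace (M ⊔ N : Submodule 𝕜 X) := h.closed_sum.completeSpace_coe
  set e := ContinuousLinearEquiv.ofBijective (sumMap M N S) (sumMap_ker hS) (sumMap_range hS)
  have he : (e : _ →L[𝕜] _) = sumMap M N S :=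
    ContinuousLinearEquiv.coe_ofBijective _ _ _
  set p : (M ⊓ S : Submodule 𝕜 X) × (M ⊓ N : Submodule 𝕜 X) × (N ⊓ S : Submodule 𝕜 X) :=
    (⟨u, hu⟩, ⟨t, ht⟩, ⟨v, hv⟩)
  have hp : ‖p‖ ≤ phiOf M N S * ‖sumMap M N S p‖ := by
    have h1 := (sumMap M N S).inverse.le_opNorm (sumMap M N S p)
    have h2 : (sumMap M N S).inverse (sumMap M N S p) = p := by
      rw [← he, ContinuousLinearMap.inverse_equiv]
      exact e.symm_apply_apply p
    rwa [h2] at h1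
  have hval : ‖sumMap M N S p‖ = ‖u + t + v‖ := by
    rw [add_assoc]; rfl
  rw [hval] at hp
  exact ⟨(norm_fst_le p).trans hp, ((norm_fst_le p.2).trans (norm_snd_le p)).trans hp,
    ((norm_snd_le p.2).trans (norm_snd_le p)).trans hp⟩

/-! ### Perturbations of the identity for pairs that are not lower semi-Fredholm -/

theorem antilipschitz_of_norm_sub_one_le {T : X →L[𝕜] X} (hT : ‖T - 1‖ ≤ 1 / 2) :
    AntilipschitzWith 2 T := by
  refine T.antilipschitz_of_bound fun x => ?_
  have h1 : ‖T x - x‖ ≤ 1 / 2 * ‖x‖ := by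
    simpa using (T - 1).le_of_opNorm_le hT x
  have h2 : ‖x‖ ≤ ‖T x - x‖ + ‖T x‖ := by
    have := norm_sub_le (T x) (T x - x)
    simp only [sub_sub_cancel] at this
    linarith
  norm_num
  linarith

/-- If `M + N` is not closed, then every closed subspace of finite codimension in `M` contains unit
vectors arbitrarily close to `N`. -/
theorem exists_unit_near_of_not_isClosed_sup [CompleteSpace X] {M N : Submodule 𝕜 X}
    (hM : IsClosed (M : Set X)) (hN : IsClosed (N : Set X))
    (hMN : ¬ IsClosed ((M ⊔ N : Submodule 𝕜 X) : Set X))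
    {F : Type*} [NormedAddCommGroup F] [NormedSpace 𝕜 F] [FiniteDimensional 𝕜 F]
    (Q : X →L[𝕜] F) {δ : ℝ} (hδ : 0 < δ) :
    ∃ m ∈ M, Q m = 0 ∧ ‖m‖ = 1 ∧ ∃ y ∈ N, ‖m - y‖ < δ := by
  by_contra hcon
  push Not at hcon
  apply hMN
  -- If unit vectors of `V` stay `δ` away from `N`, addition on `V × N` is bounded below and `V ⊔ N`
  -- is closed. As `V` has finite codimension in `M`, adding a finite-dimensional space makes `M ⊔
  -- N` closed.
  set V : Submodule 𝕜 X := M ⊓ Q.toLinearMap.ker with hV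
  have hVc : IsClosed (V : Set X) := hM.inter Q.isClosed_ker
  have hbound : ∀ m ∈ V, ∀ y ∈ N, δ * ‖m‖ ≤ ‖m + y‖ := by
    intro m hm y hy
    by_cases hm0 : m = 0
    · simp [hm0]
    have hn : 0 < ‖m‖ := norm_pos_iff.2 hm0
    have h1 := hcon ((‖m‖ : 𝕜)⁻¹ • m) (M.smul_mem _ hm.1)
      (by rw [map_smul, show Q m = 0 from hm.2, smul_zero]) (norm_smul_inv_norm hm0)
      (-((‖m‖ : 𝕜)⁻¹ • y)) (N.neg_mem (N.smul_mem _ hy))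
    rw [sub_neg_eq_add, ← smul_add, norm_smul, norm_inv, RCLike.norm_ofReal, abs_of_pos hn,
      inv_mul_eq_div, le_div_iff₀ hn] at h1
    exact h1
  have hVN : IsClosed ((V ⊔ N : Submodule 𝕜 X) : Set X) := by
    have : CompleteSpace V := hVc.completeSpace_coe
    have : CompleteSpace N := hN.completeSpace_coe
    set g : (V × N) →L[𝕜] X := V.subtypeL.coprod N.subtypeL with hg
    have hanti : AntilipschitzWith (Real.toNNReal (1 + 2 / δ)) g := by
      refine g.antilipschitz_of_bound fun p => ?_
      rw [Real.coe_toNNReal _ (by positivity)]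
      have hgp : g p = (p.1 : X) + p.2 := rfl
      have h1 := hbound p.1 p.1.2 p.2 p.2.2
      rw [← hgp] at h1
      have h1' : ‖(p.1 : X)‖ ≤ 1 / δ * ‖g p‖ := by
        rw [one_div, inv_mul_eq_div, le_div_iff₀ hδ]; linarith
      have h2 : ‖(p.2 : X)‖ ≤ ‖g p‖ + ‖(p.1 : X)‖ := by
        have h3 : (p.2 : X) = g p - p.1 := by rw [hgp]; abel
        calc ‖(p.2 : X)‖ = ‖g p - p.1‖ := by rw [← h3]
          _ ≤ _ := norm_sub_le _ _
      have h5 : 0 ≤ 1 / δ * ‖g p‖ := by positivity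
      have h4 : (1 + 2 / δ) * ‖g p‖ = ‖g p‖ + 1 / δ * ‖g p‖ + 1 / δ * ‖g p‖ := by ring
      have h6 := norm_nonneg (g p)
      rw [h4]
      refine max_le ?_ ?_
      · change ‖(p.1 : X)‖ ≤ _; linarith
      · change ‖(p.2 : X)‖ ≤ _; linarith
    have hr := hanti.isClosed_range g.uniformContinuous
    convert hr using 1
    ext x
    simp only [SetLike.mem_coe, Submodule.mem_sup, Set.mem_range, Prod.exists, Subtype.exists]
    constructor
    · rintro ⟨a, ha, b, hb, rfl⟩; exact ⟨a, ha, b, hb, rfl⟩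
    · rintro ⟨a, ha, b, hb, rfl⟩; exact ⟨a, ha, b, hb, rfl⟩
  obtain ⟨G, hG⟩ := Submodule.exists_isCompl (V.comap M.subtype)
  have hGfin : FiniteDimensional 𝕜 G := by
    refine FiniteDimensional.of_injective ((Q.toLinearMap ∘ₗ M.subtype) ∘ₗ G.subtype) ?_
    rw [← LinearMap.ker_eq_bot, LinearMap.ker_eq_bot']
    intro x hx
    have h1 : (x : M) ∈ V.comap M.subtype := ⟨(x : M).2, hx⟩
    exact Subtype.ext (Submodule.disjoint_def.1 hG.disjoint _ h1 x.2)
  have hGmap : FiniteDimensional 𝕜 (G.map M.subtype) := inferInstance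
  have hMV : M = V ⊔ G.map M.subtype := by
    have h1 := congrArg (Submodule.map M.subtype) hG.sup_eq_top
    rw [Submodule.map_sup, Submodule.map_comap_subtype, Submodule.map_top,
      Submodule.range_subtype, inf_eq_right.2 (inf_le_left : V ≤ M)] at h1
    exact h1.symm
  have h2 : M ⊔ N = (V ⊔ N) ⊔ G.map M.subtype := by
    rw [sup_right_comm, ← hMV]
  rw [h2]
  exact Submodule.isClosed_sup_finiteDimensional _ _ hVN

/-- If `M + N` is not closed, then an infinite-dimensional closed subspace of `M` is carried
into `N` by an arbitrarily small perturbation of the identity. -/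
theorem exists_perturbation_of_not_isClosed_sup [CompleteSpace X] {M N : Submodule 𝕜 X}
    (hM : IsClosed (M : Set X)) (hN : IsClosed (N : Set X))
    (hMN : ¬ IsClosed ((M ⊔ N : Submodule 𝕜 X) : Set X)) {ε : ℝ} (hε : 0 < ε) :
    ∃ K ≤ M, IsClosed (K : Set X) ∧ ¬ FiniteDimensional 𝕜 K ∧
      ∃ T : X →L[𝕜] X, ‖T - 1‖ ≤ ε ∧ K.map T.toLinearMap ≤ N := by
  classical
  -- The tuples are (index, `m`, `f`, `y`): a biorthogonal system of vectors `m ∈ M` and functionals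
  -- `f`, with `y ∈ N` so close to `m` that the rank-one operators `f ⊗ (m - y)` have norms summing
  -- to at most `ε`.
  obtain ⟨s, hs, hsr⟩ := exists_seq_of_forall_finset_exists
    (fun p : ℕ × X × (X →L[𝕜] 𝕜) × X => p.2.1 ∈ M ∧ p.2.2.1 p.2.1 = 1 ∧ p.2.2.2 ∈ N ∧
      ‖p.2.2.1‖ * ‖p.2.1 - p.2.2.2‖ ≤ ε / 2 / 2 ^ p.1)
    (fun p q => p.1 < q.1 ∧ p.2.2.1 q.2.1 = 0 ∧ q.2.2.1 p.2.1 = 0) (by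
      intro s _
      set E : Submodule 𝕜 X := Submodule.span 𝕜 (s.image fun p => p.2.1 : Finset X) with hE
      have : FiniteDimensional 𝕜 E := FiniteDimensional.span_finset 𝕜 _
      obtain ⟨P, hP⟩ := Submodule.ClosedComplemented.of_finiteDimensional E
      -- Vanishing of `Q` at the new `m` gives `P m = 0` and kills all earlier functionals at `m`.
      -- The new functional `g ∘L R` vanishes on `E`, hence at the earlier vectors, and keeps the
      -- value `1` at `m` because `R m = m`.
      set Q : X →L[𝕜] (E × (s → 𝕜)) := P.prod (ContinuousLinearMap.pi fun p => p.1.2.2.1) with hQ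
      set R : X →L[𝕜] X := 1 - E.subtypeL ∘L P with hR
      set k := s.sup Prod.fst + 1 with hk
      obtain ⟨m, hm, hQm, hm1, y, hy, hmy⟩ := exists_unit_near_of_not_isClosed_sup hM hN hMN Q
        (δ := ε / 2 / 2 ^ k / (‖R‖ + 1)) (by positivity)
      have hPm : P m = 0 := congrArg Prod.fst hQm
      have hfm : ∀ p ∈ s, p.2.2.1 m = 0 := fun p hp =>
        congrFun (congrArg Prod.snd hQm) ⟨p, hp⟩
      obtain ⟨g, hg1, hgm⟩ := exists_dual_vector 𝕜 m (by rw [hm1]; exact one_ne_zero)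
      refine ⟨(k, m, g ∘L R, y), ⟨hm, ?_, hy, ?_⟩, fun p hp => ⟨?_, hfm p hp, ?_⟩⟩
      · simp [hR, hPm, hgm, hm1]
      · have h1 : ‖g ∘L R‖ ≤ ‖R‖ := by
          have := g.opNorm_comp_le R
          rwa [hg1, one_mul] at this
        have h2 : 0 ≤ ‖R‖ := norm_nonneg R
        calc ‖g ∘L R‖ * ‖m - y‖ ≤ (‖R‖ + 1) * (ε / 2 / 2 ^ k / (‖R‖ + 1)) := by
              gcongr
              linarith
          _ = ε / 2 / 2 ^ k := by field_simp
      · exact Nat.lt_succ_of_le (Finset.le_sup (f := Prod.fst) hp)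
      · have hpE : p.2.1 ∈ E := Submodule.subset_span (by
          exact Finset.mem_coe.2 (Finset.mem_image_of_mem (fun p => p.2.1) hp))
        have h1 : (P p.2.1 : X) = p.2.1 := by rw [hP ⟨p.2.1, hpE⟩]
        simp [hR, h1])
  set m : ℕ → X := fun i => (s i).2.1
  set f : ℕ → X →L[𝕜] 𝕜 := fun i => (s i).2.2.1
  set y : ℕ → X := fun i => (s i).2.2.2
  have hfm : ∀ i j, f i (m j) = if i = j then 1 else 0 := by
    intro i j
    split_ifs with h
    · subst h; exact (hs i).2.1
    · rcases lt_or_gt_of_ne h with h | h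
      · exact (hsr i j h).2.1
      · exact (hsr j i h).2.2
  have hidx : ∀ i, i ≤ (s i).1 :=
    StrictMono.id_le (f := fun i => (s i).1) fun a b hab => (hsr a b hab).1
  set A : ℕ → X →L[𝕜] X := fun i => (f i).smulRight (m i - y i) with hA
  have hAn : ∀ i, ‖A i‖ ≤ ε / 2 / 2 ^ i := by
    intro i
    rw [hA]
    simp only [ContinuousLinearMap.norm_smulRight_apply]
    refine (hs i).2.2.2.trans ?_
    gcongr
    · norm_num
    · exact hidx i
  have hsum : HasSum (fun i : ℕ => ε / 2 / 2 ^ i) ε := hasSum_geometric_two' ε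
  have hAs : Summable A := Summable.of_norm_bounded hsum.summable hAn
  have hmem : ∀ i, m i ∈ M := fun i => (hs i).1
  refine ⟨(Submodule.span 𝕜 (Set.range m)).topologicalClosure, ?_,
    Submodule.isClosed_topologicalClosure _, ?_, 1 - ∑' i, A i, ?_, ?_⟩
  · exact Submodule.topologicalClosure_minimal _
      (Submodule.span_le.2 (by rintro _ ⟨i, rfl⟩; exact hmem i)) hM
  · intro hfin
    have hli : LinearIndependent 𝕜 m := by
      rw [linearIndependent_iff']
      intro t c hc i hi
      have h1 := congrArg (f i) hc
      simpa [hfm, hi] using h1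
    have h2 : Set.range m ⊆ (Submodule.span 𝕜 (Set.range m)).topologicalClosure :=
      Submodule.subset_span.trans (Submodule.le_topologicalClosure _)
    have h3 : LinearIndependent 𝕜
        (fun i => (⟨m i, h2 ⟨i, rfl⟩⟩ : (Submodule.span 𝕜 (Set.range m)).topologicalClosure)) :=
      LinearIndependent.of_comp (Submodule.subtype _) hli
    exact not_finite_iff_infinite.2 inferInstance h3.finite
  · rw [show (1 - ∑' i, A i) - 1 = -∑' i, A i by abel, norm_neg]
    exact tsum_of_norm_bounded hsum hAn
  · have hT : ∀ j, (1 - ∑' i, A i) (m j) = y j := by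
      intro j
      have h1 : (∑' i, A i) (m j) = ∑' i, A i (m j) :=
        (ContinuousLinearMap.apply 𝕜 X (m j)).map_tsum hAs
      have h2 : ∑' i, A i (m j) = A j (m j) :=
        tsum_eq_single j fun i hi => by simp [hA, hfm, hi]
      rw [sub_apply, h1, h2]
      simp [hA, hfm]
    rw [Submodule.map_le_iff_le_comap]
    refine Submodule.topologicalClosure_minimal _ (Submodule.span_le.2 ?_)
      (hN.preimage (1 - ∑' i, A i).continuous)
    rintro _ ⟨i, rfl⟩
    change (1 - ∑' i, A i) (m i) ∈ N
    rw [hT]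
    exact (hs i).2.2.1

/-- If a pair of closed subspaces is not lower semi-Fredholm, then an infinite-dimensional closed
subspace of the first is carried into the second by an arbitrarily small perturbation of the
identity. -/
theorem exists_perturbation_of_not_isLowerSemiFredholm [CompleteSpace X] {M N : Submodule 𝕜 X}
    (hM : IsClosed (M : Set X)) (hN : IsClosed (N : Set X))
    (hMN : ¬ IsLowerSemiFredholm M N) {ε : ℝ} (hε : 0 < ε) :
    ∃ K ≤ M, IsClosed (K : Set X) ∧ ¬ FiniteDimensional 𝕜 K ∧
      ∃ T : X →L[𝕜] X, ‖T - 1‖ ≤ ε ∧ K.map T.toLinearMap ≤ N := by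
  by_cases hc : IsClosed ((M ⊔ N : Submodule 𝕜 X) : Set X)
  -- When the sum is closed only the defect can fail, so the intersection itself serves, with the
  -- identity operator.
  · refine ⟨M ⊓ N, inf_le_left, hM.inter hN, fun hfin => hMN ⟨hM, hN, hc, ?_⟩, 1, ?_, ?_⟩
    · rw [lowerDefect, Cardinal.toENat_lt_top]
      exact Module.rank_lt_aleph0_iff.2 hfin
    · simpa using hε.le
    · rintro _ ⟨x, hx, rfl⟩
      exact hx.2
  · exact exists_perturbation_of_not_isClosed_sup hM hN hc hε

/-! ### The distance estimate -/

/-- Only `M` has its `F`-components made close by compactness, which is why `a` alone appears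
outside the factor `p`. -/
theorem exists_ne_norm_sub_lt_of_decomposition {M N U F V : Submodule 𝕜 X}
    [FiniteDimensional 𝕜 F] {p : ℝ} (hp0 : 0 ≤ p)
    (hM : ∀ y ∈ M, ∃ u ∈ U, ∃ t ∈ F, y = u + t) (hN : ∀ y ∈ N, ∃ v ∈ V, ∃ t ∈ F, y = v + t)
    (hp : ∀ u ∈ U, ∀ t ∈ F, ∀ v ∈ V, ‖u‖ ≤ p * ‖u + t + v‖ ∧ ‖t‖ ≤ p * ‖u + t + v‖)
    {D : Set ℕ} (hD : D.Infinite) {x y y' : ℕ → X} {z z' : X} {a b : ℝ}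
    (hx : ∀ n ∈ D, ‖x n‖ = 1) (hy : ∀ n ∈ D, y n ∈ M) (hy' : ∀ n ∈ D, y' n ∈ N)
    (ha : ∀ n ∈ D, ‖x n - y n - z‖ ≤ a) (hb : ∀ n ∈ D, ‖x n - y' n - z'‖ ≤ b)
    {ε : ℝ} (hε : 0 < ε) :
    ∃ n ∈ D, ∃ m ∈ D, n ≠ m ∧ ‖x n - x m‖ < 2 * (a + p * (a + b)) + ε := by
  have h1 : ∀ n, ∃ u : X, ∃ t : F, n ∈ D → u ∈ U ∧ y n = u + t := by
    intro n
    by_cases hn : n ∈ D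
    · obtain ⟨u, hu, t, ht, h⟩ := hM _ (hy n hn)
      exact ⟨u, ⟨t, ht⟩, fun _ => ⟨hu, h⟩⟩
    · exact ⟨0, 0, fun h => absurd h hn⟩
  choose u t hut using h1
  have hbd : ∀ n ∈ D, ‖t n‖ ≤ p * (1 + a + ‖z‖) := by
    intro n hn
    have h2 := (hp (u n) (hut n hn).1 (t n) (t n).2 0 V.zero_mem).2
    rw [add_zero, ← (hut n hn).2] at h2
    refine h2.trans (mul_le_mul_of_nonneg_left ?_ hp0)
    have h3 : y n = x n - (x n - y n - z) - z := by abel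
    calc ‖y n‖ = ‖x n - (x n - y n - z) - z‖ := by rw [← h3]
      _ ≤ ‖x n‖ + ‖x n - y n - z‖ + ‖z‖ :=
        (norm_sub_le _ _).trans (add_le_add_left (norm_sub_le _ _) _)
      _ ≤ 1 + a + ‖z‖ := by
        have := hx n hn
        have := ha n hn
        linarith
  obtain ⟨n, hn, m, hm, hnm, htt⟩ := exists_ne_norm_sub_lt (𝕜 := 𝕜) hD t hbd hε
  refine ⟨n, hn, m, hm, hnm, ?_⟩
  obtain ⟨v, hv, s, hs, hvs⟩ := hN _ (N.sub_mem (hy' n hn) (hy' m hm))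
  -- The three summands add up to `(y n - y m) - (y' n - y' m)`. In it `x n - x m`, `z` and `z'`
  -- cancel, leaving norm at most `2 * (a + b)`.
  have hu := (hp (u n - u m) (U.sub_mem (hut n hn).1 (hut m hm).1)
    ((t n : X) - t m - s) (F.sub_mem (F.sub_mem (t n).2 (t m).2) hs) (-v) (V.neg_mem hv)).1
  have hsum : u n - u m + ((t n : X) - t m - s) + -v
      = (x n - y' n - z') - (x m - y' m - z') - ((x n - y n - z) - (x m - y m - z)) := by
    have e1 : u n = y n - t n := by rw [(hut n hn).2]; abel
    have e2 : u m = y m - t m := by rw [(hut m hm).2]; abel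
    have e3 : v = y' n - y' m - s := by rw [hvs]; abel
    rw [e1, e2, e3]; abel
  have hd1 : ‖(x n - y n - z) - (x m - y m - z)‖ ≤ 2 * a := by
    have := norm_sub_le (x n - y n - z) (x m - y m - z)
    have := ha n hn
    have := ha m hm
    linarith
  have hd2 : ‖(x n - y' n - z') - (x m - y' m - z')‖ ≤ 2 * b := by
    have := norm_sub_le (x n - y' n - z') (x m - y' m - z')
    have := hb n hn
    have := hb m hm
    linarith
  have hu2 : ‖u n - u m‖ ≤ p * (2 * b + 2 * a) := by
    refine hu.trans (mul_le_mul_of_nonneg_left ?_ hp0)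
    rw [hsum]
    exact (norm_sub_le _ _).trans (add_le_add hd2 hd1)
  have hxx : x n - x m = ((x n - y n - z) - (x m - y m - z)) + (u n - u m) + ((t n : X) - t m) := by
    have e1 : u n = y n - t n := by rw [(hut n hn).2]; abel
    have e2 : u m = y m - t m := by rw [(hut m hm).2]; abel
    rw [e1, e2]; abel
  have htt' : ‖(t n : X) - t m‖ < ε := htt
  rw [hxx]
  refine (norm_add₃_le).trans_lt ?_
  linarith

/-! ### Elementary properties of the adjustments -/

theorem IsLowerAdjusted.mono {A B : Set ℕ} {M M' P : ℕ → Submodule 𝕜 X} {a b : ℝ}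
    (h : IsLowerAdjusted A M P a) (hB : B ⊆ A) (hM : ∀ n ∈ B, M' n ≤ M n) (hab : a ≤ b) :
    IsLowerAdjusted B M' P b := by
  intro η hη C hC hCi x hx
  obtain ⟨D, hD, hDi, y, hy, z, hz⟩ := h η hη C (hC.trans hB) hCi x
    fun n hn => ⟨hM n (hC hn) (hx n hn).1, (hx n hn).2⟩
  exact ⟨D, hD, hDi, y, hy, z, hz.trans (ENNReal.ofReal_le_ofReal (by linarith))⟩

/-- Zero approximants suffice for unit vectors. The sets whose infima define the adjustments are
therefore nonempty, and a strict upper bound on an infimum yields a member. -/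
theorem isLowerAdjusted_one (A : Set ℕ) (M P : ℕ → Submodule 𝕜 X) : IsLowerAdjusted A M P 1 := by
  intro η hη C hC hCi x hx
  refine ⟨C, subset_rfl, hCi, 0, fun n _ => (P n).zero_mem, 0, ?_⟩
  refine limsup_le_of_le (by isBoundedDefault) ?_
  filter_upwards [eventually_along_mem C] with n hn
  rw [← ofReal_norm]
  refine ENNReal.ofReal_le_ofReal ?_
  simp [(hx n hn).2, hη.le]

theorem isLowerAdjusted_of_adj_lt {A : Set ℕ} {M P : ℕ → Submodule 𝕜 X} {a : ℝ}
    (h : adj A M P < a) : IsLowerAdjusted A M P a := by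
  obtain ⟨b, ⟨_, hb⟩, hba⟩ := exists_lt_of_csInf_lt
    (by exact ⟨1, zero_le_one, isLowerAdjusted_one A M P⟩) h
  exact hb.mono subset_rfl (fun _ _ => le_rfl) hba.le

theorem adj_le_one (A : Set ℕ) (M P : ℕ → Submodule 𝕜 X) : adj A M P ≤ 1 :=
  csInf_le ⟨0, fun _ h => h.1⟩ ⟨zero_le_one, isLowerAdjusted_one A M P⟩

theorem exists_isLowerSSAdjusted_of_ssAdj_lt {A : Set ℕ} {M P : ℕ → Submodule 𝕜 X} {a : ℝ}
    (h : ssAdj A M P < a) : ∃ b < a, IsLowerSSAdjusted A M P b := by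
  have h1 : IsLowerSSAdjusted A M P 1 := fun B _ hB K hK =>
    ⟨B, subset_rfl, hB, K, fun n hn => ⟨le_rfl, (hK n hn).2⟩, adj_le_one B K P⟩
  obtain ⟨b, ⟨_, hb⟩, hba⟩ := exists_lt_of_csInf_lt (by exact ⟨1, zero_le_one, h1⟩) h
  exact ⟨b, hba, hb⟩

theorem exists_isLowerFSSAdjusted_of_fssAdj_lt {A : Set ℕ} {M P : ℕ → Submodule 𝕜 X} {a : ℝ}
    (h : fssAdj A M P < a) : ∃ b < a, IsLowerFSSAdjusted A M P b := by
  have h1 : IsLowerFSSAdjusted A M P 1 := fun B _ hB K _ hd =>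
    ⟨B, subset_rfl, hB, K, fun n _ => le_rfl, hd, adj_le_one B K P⟩
  obtain ⟨b, ⟨_, hb⟩, hba⟩ := exists_lt_of_csInf_lt (by exact ⟨1, zero_le_one, h1⟩) h
  exact ⟨b, hba, hb⟩

theorem ssAdj_nonneg (A : Set ℕ) (M P : ℕ → Submodule 𝕜 X) : 0 ≤ ssAdj A M P :=
  Real.sInf_nonneg fun _ h => h.1

theorem fssAdj_nonneg (A : Set ℕ) (M P : ℕ → Submodule 𝕜 X) : 0 ≤ fssAdj A M P :=
  Real.sInf_nonneg fun _ h => h.1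

theorem IsLowerAdjusted.exists_norm_le {A : Set ℕ} {M P : ℕ → Submodule 𝕜 X} {a c : ℝ}
    (h : IsLowerAdjusted A M P a) (hac : a < c) (hc : 0 < c) {B : Set ℕ} (hB : B ⊆ A)
    (hBi : B.Infinite) {x : ℕ → X} (hx : ∀ n ∈ B, x n ∈ M n ∧ ‖x n‖ = 1) :
    ∃ C ⊆ B, C.Infinite ∧ ∃ y : ℕ → X, ∃ z : X,
      ∀ n ∈ C, y n ∈ P n ∧ ‖x n - y n - z‖ ≤ c := by
  obtain ⟨C, hC, hCi, y, hy, z, hz⟩ := h ((c - a) / 2) (by linarith) B hB hBi x hx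
  have hlt : limsup (fun n => ‖x n - y n - z‖ₑ) (along C) < ENNReal.ofReal c :=
    hz.trans_lt ((ENNReal.ofReal_lt_ofReal_iff hc).2 (by linarith))
  refine ⟨_, fun n hn => hC hn.1, infinite_of_eventually_along hCi
    (eventually_lt_of_limsup_lt hlt), y, z, fun n hn => ⟨hy n hn.1, ?_⟩⟩
  have h1 := hn.2
  rw [← ofReal_norm, ENNReal.ofReal_lt_ofReal_iff hc] at h1
  exact h1.le

/-! ### Contradiction from simultaneous adjustment to `M` and `N` -/

/-- Subspaces `H n` of growing dimension cannot be adjusted with `M` while small perturbations of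
them are adjusted with `N`, if the adjustments are small relative to `phi M N`. -/
theorem false_of_isLowerAdjusted [CompleteSpace X] {M N : Submodule 𝕜 X}
    (hMN : IsLowerSemiFredholm M N) {C : Set ℕ} (hC : C.Infinite) {H : ℕ → Submodule 𝕜 X}
    (hrank : ∀ k : ℕ, ∀ᶠ n in along C, (k : Cardinal) ≤ Module.rank 𝕜 (H n))
    {T : ℕ → X →L[𝕜] X} (hT : ∀ n ∈ C, ‖T n - 1‖ ≤ 1 / ((n : ℝ) + 2)) {a b : ℝ}
    (ha0 : 0 < a) (hb0 : 0 < b) (ha : IsLowerAdjusted C H (fun _ => M) a)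
    (hb : IsLowerAdjusted C (fun n => (H n).map (T n).toLinearMap) (fun _ => N) b)
    (hω : omega M N a b < 1 / 2) : False := by
  -- The slack `δ` pays for passing from upper limits to termwise bounds, for choosing `S` nearly
  -- optimal and for the compactness step; `b` takes a second `δ` for replacing `x n` by its
  -- normalized image `w n`.
  obtain ⟨δ, hδ, hδω⟩ : ∃ δ : ℝ, 0 < δ ∧
      2 * (min (a + δ) (b + 2 * δ) + (phi M N + δ) * ((a + δ) + (b + 2 * δ))) + 2 * δ
        < 1 / 2 := by
    have hcont : Continuous fun δ : ℝ =>
        2 * (min (a + δ) (b + 2 * δ) + (phi M N + δ) * ((a + δ) + (b + 2 * δ))) + 2 * δ := by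
      fun_prop
    have h1 : ∀ᶠ δ in nhds (0 : ℝ),
        2 * (min (a + δ) (b + 2 * δ) + (phi M N + δ) * ((a + δ) + (b + 2 * δ))) + 2 * δ
          < 1 / 2 :=
      hcont.continuousAt.eventually_lt continuousAt_const (by simpa [omega] using hω)
    have h2 : ∀ᶠ δ in nhdsWithin (0 : ℝ) (Set.Ioi 0), 0 < δ := self_mem_nhdsWithin
    obtain ⟨δ, h3, h4⟩ := ((h1.filter_mono nhdsWithin_le_nhds).and h2).exists
    exact ⟨δ, h4, h3⟩
  set p := phi M N + δ with hp
  have hp0 : 0 < p := by have := phi_nonneg M N; linarith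
  set r := 2 * (min (a + δ) (b + 2 * δ) + p * ((a + δ) + (b + 2 * δ))) + δ with hr
  have hmin : 0 < min (a + δ) (b + 2 * δ) := lt_min (by linarith) (by linarith)
  obtain ⟨D, hDC, hD, x, hx, hsep⟩ := exists_separated_subsequence (r := r) (by positivity)
    (by linarith) hC H hrank
  obtain ⟨D₁, hD₁, hD₁i, y, z, hy⟩ := ha.exists_norm_le (c := a + δ) (by linarith) (by linarith)
    hDC hD hx
  have hTx : ∀ n ∈ D, ‖T n (x n) - x n‖ ≤ 1 / ((n : ℝ) + 2) := by
    intro n hn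
    have := (T n - 1).le_of_opNorm_le (hT n (hDC hn)) (x n)
    simpa [(hx n hn).2] using this
  have hhalf : ∀ n : ℕ, 1 / ((n : ℝ) + 2) ≤ 1 / 2 := fun n => by
    gcongr
    have : (0 : ℝ) ≤ n := n.cast_nonneg
    linarith
  have hTn : ∀ n ∈ D, |‖T n (x n)‖ - 1| ≤ 1 / ((n : ℝ) + 2) := by
    intro n hn
    have := abs_norm_sub_norm_le (T n (x n)) (x n)
    rw [(hx n hn).2] at this
    exact this.trans (hTx n hn)
  have hTpos : ∀ n ∈ D, 0 < ‖T n (x n)‖ := by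
    intro n hn
    have := (abs_le.1 ((hTn n hn).trans (hhalf n))).1
    linarith
  set w : ℕ → X := fun n => (‖T n (x n)‖ : 𝕜)⁻¹ • T n (x n) with hw
  have hw1 : ∀ n ∈ D₁, w n ∈ (H n).map (T n).toLinearMap ∧ ‖w n‖ = 1 := fun n hn =>
    ⟨Submodule.smul_mem _ _ (Submodule.mem_map_of_mem (hx n (hD₁ hn)).1),
      norm_smul_inv_norm (norm_pos_iff.1 (hTpos n (hD₁ hn)))⟩
  have hwx : ∀ n ∈ D, ‖x n - w n‖ ≤ 2 / ((n : ℝ) + 2) := by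
    intro n hn
    have h1 : T n (x n) - w n = ((‖T n (x n)‖ - 1 : ℝ) : 𝕜) • w n := by
      rw [RCLike.ofReal_sub, sub_smul, hw, RCLike.ofReal_one, one_smul]
      dsimp only
      rw [smul_inv_smul₀ (by exact_mod_cast (hTpos n hn).ne')]
    have h2 : ‖T n (x n) - w n‖ ≤ 1 / ((n : ℝ) + 2) := by
      rw [h1, norm_smul, RCLike.norm_ofReal,
        show ‖w n‖ = 1 from norm_smul_inv_norm (norm_pos_iff.1 (hTpos n hn)), mul_one]
      exact hTn n hn
    have h3 := norm_sub_le_norm_sub_add_norm_sub (x n) (T n (x n)) (w n)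
    have h4 := hTx n hn
    rw [norm_sub_rev] at h4
    have h5 : 2 / ((n : ℝ) + 2) = 1 / ((n : ℝ) + 2) + 1 / ((n : ℝ) + 2) := by ring
    linarith
  obtain ⟨D₂, hD₂, hD₂i, y', z', hy'⟩ := hb.exists_norm_le (c := b + δ) (by linarith) (by linarith)
    (hD₁.trans hDC) hD₁i hw1
  have hsmall : ∀ᶠ n : ℕ in along D₂, 2 / ((n : ℝ) + 2) < δ := by
    refine Eventually.filter_mono inf_le_left ?_
    have h1 : Tendsto (fun n : ℕ => 2 / ((n : ℝ) + 2)) atTop (nhds 0) :=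
      tendsto_const_nhds.div_atTop
        (tendsto_atTop_add_const_right _ _ tendsto_natCast_atTop_atTop)
    exact h1.eventually_lt_const hδ
  set E : Set ℕ := {n : ℕ | n ∈ D₂ ∧ 2 / ((n : ℝ) + 2) < δ} with hE
  have hEi : E.Infinite := infinite_of_eventually_along hD₂i hsmall
  have hED₁ : ∀ n ∈ E, n ∈ D₁ := fun n hn => hD₂ hn.1
  have hED : ∀ n ∈ E, n ∈ D := fun n hn => hD₁ (hED₁ n hn)
  have hxy' : ∀ n ∈ E, ‖x n - y' n - z'‖ ≤ b + 2 * δ := by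
    intro n hn
    have h1 : x n - y' n - z' = (x n - w n) + (w n - y' n - z') := by abel
    rw [h1]
    have h2 := norm_add_le (x n - w n) (w n - y' n - z')
    have h3 := (hy' n hn.1).2
    have h4 := hwx n (hED n hn)
    have h5 := hn.2
    linarith
  obtain ⟨S, hS, hSp⟩ := exists_phiOf_lt hMN (p := p) (by linarith)
  have hfin : FiniteDimensional 𝕜 (M ⊓ N : Submodule 𝕜 X) := by
    have := hMN.defect_lt_top
    rw [lowerDefect, Cardinal.toENat_lt_top] at this
    exact Module.rank_lt_aleph0_iff.1 this
  have hbound : ∀ u ∈ M ⊓ S, ∀ t ∈ M ⊓ N, ∀ v ∈ N ⊓ S,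
      ‖u‖ ≤ p * ‖u + t + v‖ ∧ ‖t‖ ≤ p * ‖u + t + v‖ ∧ ‖v‖ ≤ p * ‖u + t + v‖ := by
    intro u hu t ht v hv
    have h1 := mul_le_mul_of_nonneg_right hSp.le (norm_nonneg (u + t + v))
    obtain ⟨h2, h3, h4⟩ := norm_le_phiOf hMN hS hu ht hv
    exact ⟨h2.trans h1, h3.trans h1, h4.trans h1⟩
  -- The compactness argument is run on whichever of `M` and `N` has the smaller adjustment bound.
  obtain ⟨n, hn, m, hm, hnm, hlt⟩ : ∃ n ∈ E, ∃ m ∈ E, n ≠ m ∧ ‖x n - x m‖ < r := by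
    rcases min_choice (a + δ) (b + 2 * δ) with h | h <;> rw [hr, h]
    · exact exists_ne_norm_sub_lt_of_decomposition hp0.le (fun y hy => hS.exists_add_left hy)
        (fun y hy => hS.exists_add_right hy)
        (fun u hu t ht v hv => ⟨(hbound u hu t ht v hv).1, (hbound u hu t ht v hv).2.1⟩) hEi
        (fun n hn => (hx n (hED n hn)).2) (fun n hn => (hy n (hED₁ n hn)).1)
        (fun n hn => (hy' n hn.1).1) (fun n hn => (hy n (hED₁ n hn)).2) hxy' hδ
    · rw [add_comm (a + δ) (b + 2 * δ)]
      refine exists_ne_norm_sub_lt_of_decomposition hp0.le (fun y hy => hS.exists_add_right hy)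
        (fun y hy => hS.exists_add_left hy) (fun v hv t ht u hu => ?_) hEi
        (fun n hn => (hx n (hED n hn)).2) (fun n hn => (hy' n hn.1).1)
        (fun n hn => (hy n (hED₁ n hn)).1) hxy' (fun n hn => (hy n (hED₁ n hn)).2) hδ
      rw [show v + t + u = u + t + v by abel]
      exact ⟨(hbound u hu t ht v hv).2.2, (hbound u hu t ht v hv).2.1⟩
  exact absurd hlt (not_lt.2 (hsep n (hED n hn) m (hED m hm) hnm))

theorem exists_gt_omega_lt {M N : Submodule 𝕜 X} {a b c : ℝ} (h : omega M N a b < c) :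
    ∃ a' > a, ∃ b' > b, omega M N a' b' < c := by
  have hcont : Continuous fun δ : ℝ => omega M N (a + δ) (b + δ) := by
    unfold omega
    fun_prop
  have h1 : ∀ᶠ δ in nhds (0 : ℝ), omega M N (a + δ) (b + δ) < c :=
    hcont.continuousAt.eventually_lt continuousAt_const (by simpa using h)
  have h2 : ∀ᶠ δ in nhdsWithin (0 : ℝ) (Set.Ioi 0), 0 < δ := self_mem_nhdsWithin
  obtain ⟨δ, h3, h4⟩ := ((h1.filter_mono nhdsWithin_le_nhds).and h2).exists
  exact ⟨a + δ, by linarith, b + δ, by linarith, h3⟩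

/-- The tolerance `1 / (n + 2)` tends to zero, and the shift by two makes every `T n` bounded below,
including at `n = 0`. -/
theorem one_div_natCast_add_two_le (n : ℕ) : 1 / ((n : ℝ) + 2) ≤ 1 / 2 := by
  gcongr
  have : (0 : ℝ) ≤ n := n.cast_nonneg
  linarith

theorem map_inf_comap_eq {L L' : Submodule 𝕜 X} {f : X →ₗ[𝕜] X} (h : L' ≤ L.map f) :
    (L ⊓ L'.comap f).map f = L' := by
  refine le_antisymm (Submodule.map_le_iff_le_comap.2 inf_le_right) fun x hx => ?_
  obtain ⟨y, hy, rfl⟩ := h hx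
  exact ⟨y, ⟨hy, hx⟩, rfl⟩

/-- Successive adjustment of `L n` with `M` and of subspaces `L' n` of `T n (L n)` with `N`. -/
theorem false_of_adj_lt [CompleteSpace X] {M N : Submodule 𝕜 X}
    (hMN : IsLowerSemiFredholm M N) {C C' : Set ℕ} (hC' : C'.Infinite) (hCC' : C' ⊆ C)
    {L L' : ℕ → Submodule 𝕜 X} {T : ℕ → X →L[𝕜] X}
    (hT : ∀ n ∈ C', ‖T n - 1‖ ≤ 1 / ((n : ℝ) + 2))
    (hL' : ∀ n ∈ C', L' n ≤ (L n).map (T n).toLinearMap)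
    (hrank : ∀ k : ℕ, ∀ᶠ n in along C', (k : Cardinal) ≤ Module.rank 𝕜 (L' n)) {a b : ℝ}
    (ha0 : 0 < a) (hb0 : 0 < b) (ha : adj C L (fun _ => M) < a)
    (hb : adj C' L' (fun _ => N) < b) (hω : omega M N a b < 1 / 2) : False := by
  have hmap : ∀ n ∈ C', (L n ⊓ (L' n).comap (T n).toLinearMap).map (T n).toLinearMap = L' n :=
    fun n hn => map_inf_comap_eq (hL' n hn)
  refine false_of_isLowerAdjusted hMN hC'
    (H := fun n => L n ⊓ (L' n).comap (T n).toLinearMap) (fun k => ?_) hT ha0 hb0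
    ((isLowerAdjusted_of_adj_lt ha).mono hCC' (fun n _ => inf_le_left) le_rfl)
    ((isLowerAdjusted_of_adj_lt hb).mono subset_rfl (fun n hn => (hmap n hn).le) le_rfl) hω
  filter_upwards [hrank k, eventually_along_mem C'] with n hn hnC
  rw [← hmap n hnC] at hn
  exact hn.trans (rank_map_le _ _)

/-- Since `T n` is bounded below, the images of the subspaces adjusted to `M` are again closed and
infinite-dimensional, hence admissible for the adjustment of `Nn` to `N`. -/
theorem false_of_isLowerSSAdjusted [CompleteSpace X] {M N : Submodule 𝕜 X}
    (hMN : IsLowerSemiFredholm M N) {A B : Set ℕ} (hBA : B ⊆ A) (hB : B.Infinite)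
    {Mn Nn K : ℕ → Submodule 𝕜 X} {T : ℕ → X →L[𝕜] X}
    (hK : ∀ n ∈ B, K n ≤ Mn n ∧ IsClosed (K n : Set X) ∧ ¬ FiniteDimensional 𝕜 (K n))
    (hT : ∀ n ∈ B, ‖T n - 1‖ ≤ 1 / ((n : ℝ) + 2))
    (hKN : ∀ n ∈ B, (K n).map (T n).toLinearMap ≤ Nn n)
    (hω : omega M N (ssAdj A Mn fun _ => M) (ssAdj A Nn fun _ => N) < 1 / 2) : False := by
  obtain ⟨a, ha, b, hb, hab⟩ := exists_gt_omega_lt hω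
  have ha0 := (ssAdj_nonneg A Mn fun _ => M).trans_lt ha
  have hb0 := (ssAdj_nonneg A Nn fun _ => N).trans_lt hb
  obtain ⟨a', ha', hSM⟩ := exists_isLowerSSAdjusted_of_ssAdj_lt ha
  obtain ⟨b', hb', hSN⟩ := exists_isLowerSSAdjusted_of_ssAdj_lt hb
  obtain ⟨C, hCB, hC, L, hL, hLa⟩ := hSM B hBA hB K hK
  have hanti : ∀ n ∈ B, AntilipschitzWith 2 (T n) := fun n hn =>
    antilipschitz_of_norm_sub_one_le ((hT n hn).trans (one_div_natCast_add_two_le n))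
  obtain ⟨C', hC'C, hC', L', hL', hLb⟩ := hSN C (hCB.trans hBA) hC
    (fun n => (L n).map (T n).toLinearMap) (fun n hn =>
      ⟨(Submodule.map_mono (hL n hn).1).trans (hKN n (hCB hn)),
        ((hanti n (hCB hn)).isClosedEmbedding (T n).uniformContinuous).isClosedMap _
          (hL n hn).2.1,
        fun hfin => (hL n hn).2.2 (Module.Finite.equiv (Submodule.equivMapOfInjective
          (T n).toLinearMap (hanti n (hCB hn)).injective (L n)).symm)⟩)
  refine false_of_adj_lt hMN hC' hC'C (fun n hn => hT n (hCB (hC'C hn)))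
    (fun n hn => (hL' n hn).1) (fun k => ?_) ha0 hb0 (hLa.trans_lt ha') (hLb.trans_lt hb') hab
  filter_upwards [eventually_along_mem C'] with n hn
  have h1 : Cardinal.aleph0 ≤ Module.rank 𝕜 (L' n) :=
    not_lt.1 fun h => (hL' n hn).2.2 (Module.rank_lt_aleph0_iff.1 h)
  exact (Cardinal.natCast_lt_aleph0).le.trans h1

theorem false_of_isLowerFSSAdjusted [CompleteSpace X] {M N : Submodule 𝕜 X}
    (hMN : IsLowerSemiFredholm M N) {A B : Set ℕ} (hBA : B ⊆ A) (hB : B.Infinite)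
    {Mn Nn K : ℕ → Submodule 𝕜 X} {T : ℕ → X →L[𝕜] X}
    (hK : ∀ n ∈ B, K n ≤ Mn n ∧ FiniteDimensional 𝕜 (K n))
    (hdim : Tendsto (fun n => Module.finrank 𝕜 (K n)) (along B) atTop)
    (hT : ∀ n ∈ B, ‖T n - 1‖ ≤ 1 / ((n : ℝ) + 2))
    (hKN : ∀ n ∈ B, (K n).map (T n).toLinearMap ≤ Nn n)
    (hω : omega M N (fssAdj A Mn fun _ => M) (fssAdj A Nn fun _ => N) < 1 / 2) : False := by
  obtain ⟨a, ha, b, hb, hab⟩ := exists_gt_omega_lt hω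
  have ha0 := (fssAdj_nonneg A Mn fun _ => M).trans_lt ha
  have hb0 := (fssAdj_nonneg A Nn fun _ => N).trans_lt hb
  obtain ⟨a', ha', hSM⟩ := exists_isLowerFSSAdjusted_of_fssAdj_lt ha
  obtain ⟨b', hb', hSN⟩ := exists_isLowerFSSAdjusted_of_fssAdj_lt hb
  obtain ⟨C, hCB, hC, L, hL, hLdim, hLa⟩ := hSM B hBA hB K hK hdim
  have hLfin : ∀ n ∈ C, FiniteDimensional 𝕜 (L n) := fun n hn =>
    have := (hK n (hCB hn)).2
    Submodule.finiteDimensional_of_le (hL n hn)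
  have hanti : ∀ n ∈ B, AntilipschitzWith 2 (T n) := fun n hn =>
    antilipschitz_of_norm_sub_one_le ((hT n hn).trans (one_div_natCast_add_two_le n))
  have hmapdim : Tendsto (fun n => Module.finrank 𝕜 ((L n).map (T n).toLinearMap)) (along C)
      atTop := by
    refine hLdim.congr' ?_
    filter_upwards [eventually_along_mem C] with n hn
    exact (Submodule.equivMapOfInjective (T n).toLinearMap
      (hanti n (hCB hn)).injective (L n)).finrank_eq
  have hmapfin : ∀ n ∈ C, FiniteDimensional 𝕜 ((L n).map (T n).toLinearMap) := fun n hn =>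
    have := hLfin n hn
    inferInstance
  obtain ⟨C', hC'C, hC', L', hL', hLdim', hLb⟩ := hSN C (hCB.trans hBA) hC
    (fun n => (L n).map (T n).toLinearMap) (fun n hn =>
      ⟨(Submodule.map_mono (hL n hn)).trans (hKN n (hCB hn)), hmapfin n hn⟩) hmapdim
  refine false_of_adj_lt hMN hC' hC'C (fun n hn => hT n (hCB (hC'C hn))) hL' (fun k => ?_)
    ha0 hb0 (hLa.trans_lt ha') (hLb.trans_lt hb') hab
  filter_upwards [eventually_along_mem C', hLdim'.eventually_ge_atTop k] with n hn hk
  have := hmapfin n (hC'C hn)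
  have : FiniteDimensional 𝕜 (L' n) := Submodule.finiteDimensional_of_le (hL' n hn)
  rw [← Module.finrank_eq_rank]
  exact_mod_cast hk

/-! ### A uniform bound on the dimension of bad subspaces -/

theorem exists_le_finrank_eq {K : Submodule 𝕜 X} {k : ℕ} (h : (k : Cardinal) ≤ Module.rank 𝕜 K) :
    ∃ L ≤ K, FiniteDimensional 𝕜 L ∧ Module.finrank 𝕜 L = k := by
  obtain ⟨s, hs, hli⟩ := exists_finset_linearIndependent_of_le_rank h
  refine ⟨(Submodule.span 𝕜 (s : Set K)).map K.subtype, Submodule.map_subtype_le _ _, ?_, ?_⟩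
  · have : FiniteDimensional 𝕜 (Submodule.span 𝕜 (s : Set K)) :=
      FiniteDimensional.span_finset 𝕜 s
    infer_instance
  · rw [← (Submodule.equivMapOfInjective K.subtype K.injective_subtype _).finrank_eq]
    have := finrank_span_set_eq_card (R := 𝕜) (s := (s : Set K)) hli
    simpa [hs] using this

/-- Under the hypothesis of the theorem, there is a `k` such that, for all large `n`, no
`k`-dimensional subspace of `Mn n` is carried into `Nn n` by a small perturbation of the
identity. -/
theorem exists_eventually_of_omega_fssAdj_lt [CompleteSpace X] {M N : Submodule 𝕜 X}
    (hMN : IsLowerSemiFredholm M N) {A : Set ℕ} {Mn Nn : ℕ → Submodule 𝕜 X}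
    (hω : omega M N (fssAdj A Mn fun _ => M) (fssAdj A Nn fun _ => N) < 1 / 2) :
    ∃ k : ℕ, ∀ᶠ n in along A, ¬ ∃ K ≤ Mn n, FiniteDimensional 𝕜 K ∧ Module.finrank 𝕜 K = k ∧
      ∃ T : X →L[𝕜] X, ‖T - 1‖ ≤ 1 / ((n : ℝ) + 2) ∧ K.map T.toLinearMap ≤ Nn n := by
  by_contra! hcon
  -- If every `k` fails, a strictly increasing `φ` picks a bad subspace of dimension exactly `k` at
  -- index `φ k`; the dimensions tend to infinity along the range of `φ`.
  obtain ⟨φ, hφ, hP⟩ := extraction_forall_of_frequently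
    (P := fun k n => n ∈ A ∧ ∃ K ≤ Mn n, FiniteDimensional 𝕜 K ∧ Module.finrank 𝕜 K = k ∧
      ∃ T : X →L[𝕜] X, ‖T - 1‖ ≤ 1 / ((n : ℝ) + 2) ∧ K.map T.toLinearMap ≤ Nn n)
    (fun k => frequently_inf_principal.1 (hcon k))
  choose hA K hK hfin hdim T hT hKT using hP
  have hKe : ∀ k, Function.extend φ K (fun _ => ⊥) (φ k) = K k := hφ.injective.extend_apply _ _
  have hTe : ∀ k, Function.extend φ T (fun _ => 1) (φ k) = T k := hφ.injective.extend_apply _ _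
  refine false_of_isLowerFSSAdjusted hMN (B := Set.range φ) (by rintro _ ⟨k, rfl⟩; exact hA k)
    (Set.infinite_range_of_injective hφ.injective) (K := Function.extend φ K fun _ => ⊥)
    (T := Function.extend φ T fun _ => 1) ?_ ?_ ?_ ?_ hω
  · rintro _ ⟨k, rfl⟩
    rw [hKe]
    exact ⟨hK k, hfin k⟩
  · refine tendsto_atTop.2 fun l => eventually_inf_principal.2 ?_
    filter_upwards [eventually_ge_atTop (φ l)]
    rintro _ hl ⟨k, rfl⟩
    rw [hKe, hdim]
    exact hφ.le_iff_le.1 hl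
  · rintro _ ⟨k, rfl⟩
    rw [hTe]
    exact hT k
  · rintro _ ⟨k, rfl⟩
    rw [hTe, hKe]
    exact hKT k

end SingularAdjustment

theorem theorem4p2p2 {𝕜 : Type*} [RCLike 𝕜] {X : Type*} [NormedAddCommGroup X]
    [NormedSpace 𝕜 X] [CompleteSpace X]
    (M N : Submodule 𝕜 X) (hMN : SingularAdjustment.IsLowerSemiFredholm M N)
    (A : Set ℕ) (hA : A.Infinite) (Mn Nn : ℕ → Submodule 𝕜 X)
    (hMn : ∀ n ∈ A, IsClosed (Mn n : Set X)) (hNn : ∀ n ∈ A, IsClosed (Nn n : Set X)) :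
    (SingularAdjustment.omega M N
        (SingularAdjustment.fssAdj A Mn (fun _ => M))
        (SingularAdjustment.fssAdj A Nn (fun _ => N)) < 1 / 2 →
      (∀ᶠ n in SingularAdjustment.along A,
        SingularAdjustment.IsLowerSemiFredholm (Mn n) (Nn n)) ∧
      Filter.limsup (fun n => SingularAdjustment.lowerDefect (Mn n) (Nn n))
        (SingularAdjustment.along A) < ⊤) ∧
    (SingularAdjustment.omega M N
        (SingularAdjustment.ssAdj A Mn (fun _ => M))
        (SingularAdjustment.ssAdj A Nn (fun _ => N)) < 1 / 2 →
      ∀ᶠ n in SingularAdjustment.along A,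
        SingularAdjustment.IsLowerSemiFredholm (Mn n) (Nn n)) := by
  open SingularAdjustment in
  have hpos : ∀ n : ℕ, (0 : ℝ) < 1 / ((n : ℝ) + 2) := fun n => by positivity
  refine ⟨fun hω => ?_, fun hω => ?_⟩
  · obtain ⟨k, hk⟩ := exists_eventually_of_omega_fssAdj_lt hMN hω
    refine ⟨?_, ?_⟩
    · filter_upwards [hk, eventually_along_mem A] with n hn hnA
      by_contra hbad
      obtain ⟨K, hKM, _, hKinf, T, hT, hKT⟩ :=
        exists_perturbation_of_not_isLowerSemiFredholm (hMn n hnA) (hNn n hnA) hbad (hpos n)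
      have hrank : (k : Cardinal) ≤ Module.rank 𝕜 K :=
        Cardinal.natCast_lt_aleph0.le.trans
          (not_lt.1 fun h => hKinf (Module.rank_lt_aleph0_iff.1 h))
      obtain ⟨L, hLK, hLfin, hLdim⟩ := exists_le_finrank_eq hrank
      exact hn ⟨L, hLK.trans hKM, hLfin, hLdim, T, hT, (Submodule.map_mono hLK).trans hKT⟩
    · refine lt_of_le_of_lt (b := (k : ℕ∞)) ?_ (ENat.natCast_lt_top k)
      refine limsup_le_of_le (by isBoundedDefault) ?_
      filter_upwards [hk] with n hn
      -- A defect above `k` would give a `k`-dimensional subspace of the intersection, which is bad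
      -- with `T = 1`.
      by_contra! hlt
      obtain ⟨L, hL, hLfin, hLdim⟩ :=
        exists_le_finrank_eq (Cardinal.natCast_le_toENat.1 hlt.le)
      refine hn ⟨L, hL.trans inf_le_left, hLfin, hLdim, 1, by simpa using (hpos n).le, ?_⟩
      rintro _ ⟨x, hx, rfl⟩
      exact (hL hx).2
  · by_contra hcon
    have hB : {n | n ∈ A ∧ ¬ IsLowerSemiFredholm (Mn n) (Nn n)}.Infinite :=
      frequently_along.1 (not_eventually.1 hcon)
    have hex : ∀ n, ∃ (K : Submodule 𝕜 X) (T : X →L[𝕜] X),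
        n ∈ {n | n ∈ A ∧ ¬ IsLowerSemiFredholm (Mn n) (Nn n)} →
          (K ≤ Mn n ∧ IsClosed (K : Set X) ∧ ¬ FiniteDimensional 𝕜 K) ∧
            ‖T - 1‖ ≤ 1 / ((n : ℝ) + 2) ∧ K.map T.toLinearMap ≤ Nn n := by
      intro n
      by_cases hn : n ∈ {n | n ∈ A ∧ ¬ IsLowerSemiFredholm (Mn n) (Nn n)}
      · obtain ⟨K, hKM, hKc, hKinf, T, hT, hKT⟩ :=
          exists_perturbation_of_not_isLowerSemiFredholm (hMn n hn.1) (hNn n hn.1) hn.2 (hpos n)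
        exact ⟨K, T, fun _ => ⟨⟨hKM, hKc, hKinf⟩, hT, hKT⟩⟩
      · exact ⟨⊥, 1, fun h => absurd h hn⟩
    choose K T hKT using hex
    exact false_of_isLowerSSAdjusted hMN (fun n hn => hn.1) hB (fun n hn => (hKT n hn).1)
      (fun n hn => (hKT n hn).2.1) (fun n hn => (hKT n hn).2.2) hω
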